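/- Let $\mathcal P=(\mathcal P,\{-\},\bigcup)$ be the power set monad on the category $\mathbf{Set}$ and let $\mathbb S=\{0,1\}$ be the Sierpinski space, with open sets $\emptyset,\{1\},\{0,1\}$. Let $U_{\mathcal P}\colon \mathbf{Kl}(\mathcal P)\to\mathbf{Top}$ be the functor sending a set $X$ to the product space $\mathbb S^X$ (whose points are identified with the subsets of $X$) and a Kleisli morphism $f\colon X\to\mathcal P Y$ to the continuous map $\mathbb S^X\to\mathbb S^Y$, $A\mapsto\bigcup_{x\in A}f(x)$. Let $\mathbb V_\downarrow$ be the lower Vietoris monad (Hoare hyperspace monad) on $\mathbf{Top}$: the space $\mathbb V_\downarrow X$ consists of all closed subsets of $X$, with the topology generated by the sets $\Diamond U=\{C : C\cap U\neq\emptyset\}$ for $U\subseteq X$ open; a continuous map $f\colon X\to Y$ acts by $C\mapsto\overline{f[C]}$; the unit is $x\mapsto\overline{\{x\}}$ and the multiplication is $\mathcal C\mapsto\overline{\bigcup\mathcal C}$. The codensity monad of a functor $F$ is the right Kan extension $\mathrm{Ran}_F F$ with unit and multiplication induced by its universal property. **Theorem.** 1. The right Kan extension of $U_{\mathcal P}$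 along itself exists and is pointwise (for each space $X$ the limit $\lim_{f\colon X\to U_{\mathcal P}A}U_{\mathcal P}A$ exists in $\mathbf{Top}$), and $\mathbb V_\downarrow$ is isomorphic, as a monad, to the codensity monad of $U_{\mathcal P}$. 2. Let $\mathbf{CJSL}$ be the category of complete join-semilattices and maps preserving all joins. Let $\mathbf{Top}(-,\mathbb S)\dashv\mathbf{CJSL}(-,2)\colon\mathbf{CJSL}^{\mathrm{op}}\to\mathbf{Top}$ be the dual adjunction in which $\mathbf{Top}(X,\mathbb S)$ is the lattice of open subsets of $X$ and $\mathbf{CJSL}(J,2)$ is topologized as a subspace of $\mathbb S^{J}$. The maps $\mathbb V_\downarrow X\to\mathbf{CJSL}(\mathbf{Top}(X,\mathbb S),2)$ sending a closed set $C$ to the morphism $\chi_C$ with $\chi_C(U)=1$ iff $C\cap U\neq\emptyset$ form an isomorphism of monads from $\mathbb V_\downarrow$ to the monad induced by this adjunction. -/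

import Mathlib

open CategoryTheory TopologicalSpace Opposite

universe w v' v u

/-! ### The codensity monad of a functor -/

section Codensity

variable {A : Type w} {C : Type u} [Category.{v} C]

/-- The codensity monad `(Ran_F F, η, μ)` of a functor `F : A ⥤ C` whose right Kan extension along
itself exists. With `φ : F ⋙ Ran_F F ⟶ F` the counit, `η` is the transformation corresponding to
`𝟙 : F ⟶ F`, and `μ` the one corresponding to
`(Ran_F F) (Ran_F F) F ⟶ (Ran_F F) F ⟶ F`, the composite of `(Ran_F F) φ` and `φ`. -/
noncomputable def codensityMonad [Category.{v'} A] (F : A ⥤ C) [F.HasRightKanExtension F] :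
    Monad C where
  toFunctor := F.rightKanExtension F
  η := (F.rightKanExtension F).liftOfIsRightKanExtension (F.rightKanExtensionCounit F)
    (𝟭 C) F.rightUnitor.hom
  μ := (F.rightKanExtension F).liftOfIsRightKanExtension (F.rightKanExtensionCounit F)
    (F.rightKanExtension F ⋙ F.rightKanExtension F)
    ((Functor.associator F (F.rightKanExtension F) (F.rightKanExtension F)).inv ≫
      Functor.whiskerRight (F.rightKanExtensionCounit F) (F.rightKanExtension F) ≫
      F.rightKanExtensionCounit F)
  assoc := by
    set T := F.rightKanExtension F
    set φ := F.rightKanExtensionCounit F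
    set m := T.liftOfIsRightKanExtension φ (T ⋙ T) ((Functor.associator F T T).inv ≫
      Functor.whiskerRight φ T ≫ φ) with hm
    have key (X : A) : m.app (F.obj X) ≫ φ.app X = T.map (φ.app X) ≫ φ.app X := by
      simp [hm]
    have h : Functor.whiskerRight m T ≫ m =
        (Functor.associator T T T).hom ≫ Functor.whiskerLeft T m ≫ m := by
      apply T.hom_ext_of_isRightKanExtension φ
      ext X
      simp only [NatTrans.comp_app, Functor.whiskerLeft_app, Functor.whiskerRight_app,
        Functor.associator_hom_app, Category.assoc, key, Category.id_comp]
      rw [← T.map_comp_assoc, key, T.map_comp_assoc]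
      refine Eq.trans ?_ (m.naturality_assoc (φ.app X) (φ.app X))
      rw [key]
      rfl
    intro X
    simpa using NatTrans.congr_app h X
  left_unit := by
    set T := F.rightKanExtension F
    set φ := F.rightKanExtensionCounit F
    set m := T.liftOfIsRightKanExtension φ (T ⋙ T) ((Functor.associator F T T).inv ≫
      Functor.whiskerRight φ T ≫ φ) with hm
    set e := T.liftOfIsRightKanExtension φ (𝟭 C) F.rightUnitor.hom with he
    have key (X : A) : m.app (F.obj X) ≫ φ.app X = T.map (φ.app X) ≫ φ.app X := by
      simp [hm]
    have key' (X : A) : e.app (F.obj X) ≫ φ.app X = 𝟙 _ := by simp [he]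
    have h : T.rightUnitor.inv ≫ (Functor.whiskerLeft T e) ≫ m = 𝟙 T := by
      apply T.hom_ext_of_isRightKanExtension φ
      ext X
      simp only [NatTrans.comp_app, Functor.whiskerLeft_app,
        Functor.rightUnitor_inv_app, Category.assoc, key, Category.id_comp]
      refine (e.naturality_assoc (φ.app X) (φ.app X)).symm.trans ?_
      rw [key']
      simp
    intro X
    simpa using NatTrans.congr_app h X
  right_unit := by
    set T := F.rightKanExtension F
    set φ := F.rightKanExtensionCounit F
    set m := T.liftOfIsRightKanExtension φ (T ⋙ T) ((Functor.associator F T T).inv ≫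
      Functor.whiskerRight φ T ≫ φ) with hm
    set e := T.liftOfIsRightKanExtension φ (𝟭 C) F.rightUnitor.hom with he
    have key (X : A) : m.app (F.obj X) ≫ φ.app X = T.map (φ.app X) ≫ φ.app X := by
      simp [hm]
    have key' (X : A) : e.app (F.obj X) ≫ φ.app X = 𝟙 _ := by simp [he]
    have h : T.leftUnitor.inv ≫ (Functor.whiskerRight e T) ≫ m = 𝟙 T := by
      apply T.hom_ext_of_isRightKanExtension φ
      ext X
      simp only [NatTrans.comp_app, Functor.whiskerLeft_app, Functor.whiskerRight_app,
        Functor.leftUnitor_inv_app, Category.assoc, key, Category.id_comp]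
      rw [← T.map_comp_assoc, key']
      simp
    intro X
    simpa using NatTrans.congr_app h X

end Codensity

/-! ### The power set monad and the functor `U_P : Kl(P) ⥤ Top` -/

/-- The power set monad `P` on the category of sets: `P X` is the set of subsets of `X`, functions
act by direct image, the unit is `x ↦ {x}`, the multiplication is union. -/
def powersetMonad : Monad (Type u) where
  obj X := Set X
  map f := ↾(fun S => f '' S)
  map_id X := TypeCat.Hom.ext <| TypeCat.Fun.ext <| funext fun S : Set X => Set.image_id S
  map_comp f g := TypeCat.Hom.ext <| TypeCat.Fun.ext <| funext fun S =>
    Set.image_comp g f S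
  η :=
    { app X := ↾(fun x => ({x} : Set X))
      naturality X Y f := TypeCat.Hom.ext <| TypeCat.Fun.ext <| funext fun x =>
        (Set.image_singleton (f := f) (a := x)).symm }
  μ :=
    { app X := ↾(fun S : Set (Set X) => ⋃₀ S)
      naturality X Y f := TypeCat.Hom.ext <| TypeCat.Fun.ext <| funext fun S =>
        (Set.image_sUnion (f := f) (s := S)).symm }
  assoc X := TypeCat.Hom.ext <| TypeCat.Fun.ext <| funext fun (S : Set (Set (Set X))) => by
    change ⋃₀ ((fun T => ⋃₀ T) '' S) = ⋃₀ ⋃₀ S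
    ext x
    simp only [Set.mem_sUnion, Set.mem_image]
    grind
  left_unit X := TypeCat.Hom.ext <| TypeCat.Fun.ext <| funext fun (S : Set X) =>
    Set.sUnion_singleton S
  right_unit X := TypeCat.Hom.ext <| TypeCat.Fun.ext <| funext fun (S : Set X) =>
    (Set.sUnion_image _ _).trans (Set.biUnion_of_singleton S)

/-- The map `𝕊 ^ X → 𝕊 ^ Y` induced by `f : X → P Y`. With subsets identified with their indicator
functions, it is `A ↦ ⋃ x ∈ A, f x`. Here the Sierpinski space `𝕊` is `Prop` with `{True}` open. -/
def sierpinskiPowerMap {X Y : Type u} (f : X → Set Y) : C(X → Prop, Y → Prop) where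
  toFun A y := ∃ x, A x ∧ y ∈ f x
  continuous_toFun := by
    refine continuous_pi fun y => continuous_Prop.2 ?_
    have : {A : X → Prop | ∃ x, A x ∧ y ∈ f x} = ⋃ x ∈ {x : X | y ∈ f x}, {A | A x} := by
      ext A
      simp [and_comm]
    rw [this]
    exact isOpen_biUnion fun x _ => continuous_Prop.1 (continuous_apply x)

/-- The forgetful functor `U_P : Kl(P) ⥤ Top` of the Kleisli category of the power set monad. It
sends `X` to the power `𝕊 ^ X` of the Sierpinski space, a subset of `X` being identified with its
indicator function, and it acts on Kleisli morphisms as the canonical functor `Kl(P) ⥤ Set`. -/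
def powersetKleisliToTop : Kleisli powersetMonad.{u} ⥤ TopCat.{u} where
  obj X := TopCat.of (X.of → Prop)
  map {X Y} f := TopCat.ofHom (sierpinskiPowerMap (fun x => (show Set Y.of from f.of x)))
  map_id _ := TopCat.hom_ext <| ContinuousMap.ext fun _ => funext fun y => propext
    ⟨fun ⟨x, hx, hy⟩ => (show y = x from hy) ▸ hx, fun hy => ⟨y, hy, rfl⟩⟩
  map_comp _ _ := TopCat.hom_ext <| ContinuousMap.ext fun _ => funext fun _ => propext
    ⟨fun ⟨x, hx, _, ⟨y, hy, rfl⟩, hz⟩ => ⟨y, ⟨x, hx, hy⟩, hz⟩,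
      fun ⟨y, ⟨x, hx, hy⟩, hz⟩ => ⟨x, hx, _, ⟨y, hy, rfl⟩, hz⟩⟩

/-- `U_P` acts on Kleisli morphisms as the canonical functor `Kl(P) ⥤ Set`, `f ↦ μ ∘ P f`. -/
theorem powersetKleisliToTop_map {X Y : Kleisli powersetMonad.{u}} (f : X ⟶ Y) (S : Set X.of) :
    {y : Y.of | (show Y.of → Prop from powersetKleisliToTop.map f (fun x : X.of => x ∈ S)) y} =
      (Kleisli.Adjunction.fromKleisli powersetMonad.{u}).map f S := by
  refine Set.ext fun y => ⟨?_, ?_⟩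
  · rintro ⟨x, hx, hy⟩
    exact ⟨_, ⟨x, hx, rfl⟩, hy⟩
  · rintro ⟨_, ⟨x, hx, rfl⟩, hy⟩
    exact ⟨x, hx, hy⟩

/-! ### The lower Vietoris monad -/

section LowerVietoris

/-- The lower Vietoris topology on the set of closed subsets of `X`: it is generated by the sets
`◇U = {C | C ∩ U ≠ ∅}` for `U ⊆ X` open. -/
@[reducible] def lowerVietorisTopology (X : Type u) [TopologicalSpace X] :
    TopologicalSpace (Closeds X) :=
  .generateFrom {S | ∃ U : Set X, IsOpen U ∧ S = {C : Closeds X | ((C : Set X) ∩ U).Nonempty}}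

attribute [local instance] lowerVietorisTopology

theorem isOpen_hit {X : Type u} [TopologicalSpace X] {U : Set X} (hU : IsOpen U) :
    IsOpen {C : Closeds X | ((C : Set X) ∩ U).Nonempty} :=
  isOpen_generateFrom_of_mem ⟨U, hU, rfl⟩

theorem continuous_of_hit {X Z : Type u} [TopologicalSpace X] [TopologicalSpace Z]
    {g : Z → Closeds X}
    (h : ∀ U : Set X, IsOpen U → IsOpen {z | ((g z : Set X) ∩ U).Nonempty}) : Continuous g :=
  continuous_generateFrom_iff.2 (by rintro _ ⟨U, hU, rfl⟩; exact h U hU)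

theorem closeds_ext_of_hit {X : Type u} [TopologicalSpace X] {C D : Closeds X}
    (h : ∀ U : Set X, IsOpen U → (((C : Set X) ∩ U).Nonempty ↔ ((D : Set X) ∩ U).Nonempty)) :
    C = D := by
  have key : ∀ E F : Closeds X,
      (∀ U : Set X, IsOpen U → ((E : Set X) ∩ U).Nonempty → ((F : Set X) ∩ U).Nonempty) →
      (E : Set X) ⊆ F := by
    intro E F h x hx
    by_contra hF
    obtain ⟨y, hy, hy'⟩ := h (F : Set X)ᶜ F.isClosed.isOpen_compl ⟨x, hx, hF⟩
    exact hy' hy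
  exact Closeds.ext (Set.Subset.antisymm (key C D fun U hU => (h U hU).1)
    (key D C fun U hU => (h U hU).2))

theorem hit_image {X Y : Type u} [TopologicalSpace X] [TopologicalSpace Y] (f : X → Y)
    (C : Set X) {U : Set Y} (hU : IsOpen U) :
    ((Closeds.closure (f '' C) : Set Y) ∩ U).Nonempty ↔ (C ∩ f ⁻¹' U).Nonempty := by
  rw [Closeds.coe_closure, closure_inter_open_nonempty_iff hU, Set.image_inter_nonempty_iff]

theorem hit_singleton {X : Type u} [TopologicalSpace X] (x : X) {U : Set X} (hU : IsOpen U) :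
    ((Closeds.closure {x} : Set X) ∩ U).Nonempty ↔ x ∈ U := by
  rw [Closeds.coe_closure, closure_inter_open_nonempty_iff hU, Set.singleton_inter_nonempty]

theorem hit_biUnion {X : Type u} [TopologicalSpace X] (S : Set (Closeds X)) {U : Set X}
    (hU : IsOpen U) :
    ((Closeds.closure (⋃ C ∈ S, (C : Set X)) : Set X) ∩ U).Nonempty ↔
      (S ∩ {C : Closeds X | ((C : Set X) ∩ U).Nonempty}).Nonempty := by
  rw [Closeds.coe_closure, closure_inter_open_nonempty_iff hU]
  constructor
  · rintro ⟨x, hx, hxU⟩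
    simp only [Set.mem_iUnion] at hx
    obtain ⟨C, hC, hx⟩ := hx
    exact ⟨C, hC, x, hx, hxU⟩
  · rintro ⟨C, hC, x, hx, hxU⟩
    exact ⟨x, Set.mem_biUnion hC hx, hxU⟩

/-- The lower Vietoris monad (Hoare hyperspace monad) on `Top`. It sends `X` to the space of its
closed subsets with the lower Vietoris topology, and a continuous map `f` to `C ↦ closure (f '' C)`.
The unit is `x ↦ closure {x}`, and the multiplication is `𝒞 ↦ closure (⋃ C ∈ 𝒞, C)`. -/
def lowerVietorisMonad : Monad TopCat.{u} where
  obj X := TopCat.of (Closeds X)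
  map {X Y} f := TopCat.ofHom
    { toFun := fun C => Closeds.closure (f '' (C : Set X))
      continuous_toFun := continuous_of_hit fun U hU => by
        simp only [hit_image _ _ hU]
        exact isOpen_hit (hU.preimage f.hom.continuous) }
  map_id X := TopCat.hom_ext <| ContinuousMap.ext fun C => closeds_ext_of_hit fun U hU =>
    hit_image _ _ hU
  map_comp {X Y Z} f g := TopCat.hom_ext <| ContinuousMap.ext fun C =>
    closeds_ext_of_hit fun U hU => (hit_image _ _ hU).trans <| Iff.symm <|
      (hit_image g _ hU).trans (hit_image f _ (hU.preimage g.hom.continuous))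
  η :=
    { app X := TopCat.ofHom
        { toFun := fun x => Closeds.closure ({x} : Set X)
          continuous_toFun := continuous_of_hit fun U hU => by
            simp only [hit_singleton _ hU]
            exact hU }
      naturality X Y f := TopCat.hom_ext <| ContinuousMap.ext fun x =>
        closeds_ext_of_hit fun U hU => (hit_singleton (f x) hU).trans <| Iff.symm <|
          (hit_image f _ hU).trans (hit_singleton x (hU.preimage f.hom.continuous)) }
  μ :=
    { app X := TopCat.ofHom
        { toFun := fun (𝒞 : Closeds (Closeds X)) =>
            Closeds.closure (⋃ C ∈ (𝒞 : Set (Closeds X)), (C : Set X))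
          continuous_toFun := continuous_of_hit fun U hU => by
            simp only [hit_biUnion _ hU]
            exact isOpen_hit (isOpen_hit hU) }
      naturality X Y f := TopCat.hom_ext <| ContinuousMap.ext fun 𝒞 =>
        closeds_ext_of_hit fun U hU => by
          refine (hit_biUnion _ hU).trans ((hit_image _ _ (isOpen_hit hU)).trans ?_)
          refine Iff.trans ?_ ((hit_image f _ hU).trans
            (hit_biUnion _ (hU.preimage f.hom.continuous))).symm
          exact iff_of_eq (congrArg (fun S => Set.Nonempty (_ ∩ S))
            (Set.ext fun C => hit_image f (C : Set X) hU)) }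
  assoc X := TopCat.hom_ext <| ContinuousMap.ext fun 𝒞 => closeds_ext_of_hit fun U hU => by
    refine (hit_biUnion _ hU).trans ((hit_image _ _ (isOpen_hit hU)).trans ?_)
    refine Iff.trans ?_ ((hit_biUnion _ hU).trans (hit_biUnion _ (isOpen_hit hU))).symm
    exact iff_of_eq (congrArg (fun S => Set.Nonempty (_ ∩ S))
      (Set.ext fun C => hit_biUnion (show Closeds (Closeds X) from C : Set (Closeds X)) hU))
  left_unit X := TopCat.hom_ext <| ContinuousMap.ext fun C => closeds_ext_of_hit fun U hU =>
    (hit_biUnion _ hU).trans (hit_singleton C (isOpen_hit hU))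
  right_unit X := TopCat.hom_ext <| ContinuousMap.ext fun C => closeds_ext_of_hit fun U hU => by
    refine (hit_biUnion _ hU).trans ((hit_image _ _ (isOpen_hit hU)).trans ?_)
    exact iff_of_eq (congrArg (fun S => Set.Nonempty (_ ∩ S))
      (Set.ext fun x => hit_singleton x hU))

end LowerVietoris

/-! ### Complete join-semilattices and the dual adjunction `Top(-, 𝕊) ⊣ CJSL(-, 2)` -/

/-- The category of complete join-semilattices and maps preserving arbitrary joins. -/
structure CJSL where
  /-- The underlying set. -/
  carrier : Type u
  [str : CompleteSemilatticeSup carrier]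

attribute [instance] CJSL.str

instance : Category CJSL.{u} where
  Hom J K := sSupHom J.carrier K.carrier
  id J := sSupHom.id J.carrier
  comp f g := sSupHom.comp g f

/-- `CJSL(J, 2)` as a subspace of the power `𝕊 ^ J` of the Sierpinski space, where `2 = Prop` with
`False < True`. -/
instance sSupHomPropTopology (J : Type u) [SupSet J] : TopologicalSpace (sSupHom J Prop) :=
  .induced (fun h : sSupHom J Prop => (h : J → Prop)) inferInstance

/-- The functor `Top(-, 𝕊) : Top ⥤ CJSLᵒᵖ`: continuous maps `X → 𝕊` are identified with open subsets
of `X`, and a continuous map acts by preimage. -/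
def opensCJSL : TopCat.{u} ⥤ CJSL.{u}ᵒᵖ where
  obj X := op ⟨Opens X⟩
  map {X Y} f := Quiver.Hom.op (X := CJSL.mk (Opens Y)) (Y := CJSL.mk (Opens X))
    (Opens.comap f.hom : sSupHom (Opens Y) (Opens X))
  map_id _ := rfl
  map_comp _ _ := rfl

/-- The functor `CJSL(-, 2) : CJSLᵒᵖ ⥤ Top`, acting on morphisms by precomposition. -/
def dualCJSL : CJSL.{u}ᵒᵖ ⥤ TopCat.{u} where
  obj J := TopCat.of (sSupHom J.unop.carrier Prop)
  map {J K} f := TopCat.ofHom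
    { toFun := fun h => sSupHom.comp h f.unop
      continuous_toFun := continuous_induced_rng.2 <| continuous_pi fun k =>
        (continuous_apply (DFunLike.coe (F := sSupHom K.unop.carrier J.unop.carrier) f.unop k)).comp
          continuous_induced_dom }
  map_id J := rfl
  map_comp f g := rfl

/-- The map `X → CJSL(J, 2)` corresponding to a join-preserving map `h : J → Top(X, 𝕊)`, given by
`x ↦ (j ↦ x ∈ h j)`. -/
def toDualMap {X J : Type u} [TopologicalSpace X] [CompleteSemilatticeSup J]
    (h : sSupHom J (Opens X)) : C(X, sSupHom J Prop) where
  toFun x :=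
    { toFun := fun j => x ∈ h j
      map_sSup' := fun S => by
        rw [map_sSup]
        simp only [sSup_Prop_eq, Set.exists_mem_image, Opens.mem_sSup] }
  continuous_toFun := continuous_induced_rng.2 <| continuous_pi fun j =>
    continuous_Prop.2 (h j).isOpen

/-- The join-preserving map `J → Top(X, 𝕊)` corresponding to a continuous map `g : X → CJSL(J, 2)`,
given by `j ↦ {x | g x j}`. -/
def ofDualMap {X J : Type u} [TopologicalSpace X] [CompleteSemilatticeSup J]
    (g : C(X, sSupHom J Prop)) : sSupHom J (Opens X) where
  toFun j := ⟨{x | g x j},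
    continuous_Prop.1 ((continuous_apply j).comp (continuous_induced_dom.comp g.continuous))⟩
  map_sSup' S := by
    ext x
    simp [sSup_Prop_eq, map_sSup, -eq_iff_iff]

/-- The dual adjunction `Top(-, 𝕊) ⊣ CJSL(-, 2)`: join-preserving maps `h : J → Top(X, 𝕊)` and
continuous maps `g : X → CJSL(J, 2)` correspond via `x ∈ h j ↔ g x j`. -/
def opensDualAdjunction : opensCJSL.{u} ⊣ dualCJSL.{u} :=
  Adjunction.mkOfHomEquiv
    { homEquiv X J :=
        { toFun := fun h => TopCat.ofHom (Y := sSupHom J.unop.carrier Prop)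
            (toDualMap (J := J.unop.carrier) h.unop)
          invFun := fun g => Quiver.Hom.op (X := J.unop) (Y := CJSL.mk (Opens X))
            (ofDualMap (J := J.unop.carrier) (show C(X, sSupHom J.unop.carrier Prop) from g.hom))
          left_inv := fun _ => rfl
          right_inv := fun _ => rfl }
      homEquiv_naturality_left_symm := fun _ _ => rfl
      homEquiv_naturality_right := fun _ _ => rfl }

/-!
A point `z` of a cone over the diagram of all continuous maps `X → 𝕊 ^ A` assigns a truth value to
every open subset of `X`, through the legs at the maps `X → 𝕊`. Projections between powers of `𝕊`
show that these truth values determine every leg, and the Kleisli morphisms `A → P 1` which are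
constantly `1` show that they are compatible with arbitrary unions. So `z` is a join-preserving map
from the open sets to `2`, and such a map is `U ↦ (C ∩ U ≠ ∅)` for a unique closed set `C`, the
complement of the largest open set mapped to `0`; the sets `◇U` are the preimages of the subbasic
open sets of the power of `𝕊` indexed by the open sets. This makes the space of closed sets both the
limit of the diagram and the double dual of `X` under the adjunction with complete
join-semilattices.

The monad structures agree because each power `𝕊 ^ A` carries an algebra structure for the lower
Vietoris monad, natural in `A`, and a monad structure on a right Kan extension of `F` along itself
is determined by its action on `F`.
-/

section MonadAction

variable {A : Type w} {C : Type u} [Category.{v} C] [Category.{v'} A]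

/-- A (left) action of a monad `M` on a functor `F`: a family of `M`-algebra structures on the
objects `F X` which is natural in `X`. The codensity monad of `F` is the universal monad acting
on `F`. -/
structure MonadAction (M : Monad C) (F : A ⥤ C) where
  /-- The structure maps of the algebras. -/
  hom : F ⋙ M.toFunctor ⟶ F
  unit (X : A) : M.η.app (F.obj X) ≫ hom.app X = 𝟙 (F.obj X)
  assoc (X : A) : M.μ.app (F.obj X) ≫ hom.app X = M.map (hom.app X) ≫ hom.app X

namespace MonadAction

variable {M N : Monad C} {F : A ⥤ C} (α : MonadAction M F) (β : MonadAction N F)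
  [N.toFunctor.IsRightKanExtension β.hom]

/-- The morphism of monads through which an action of `M` on `F` factors, for a monad `N` whose
action on `F` exhibits it as a right Kan extension of `F` along itself. -/
noncomputable def lift : M ⟶ N where
  toNatTrans := N.toFunctor.liftOfIsRightKanExtension β.hom M.toFunctor α.hom
  app_η := by
    set e := N.toFunctor.liftOfIsRightKanExtension β.hom M.toFunctor α.hom
    have h : M.η ≫ e = N.η := by
      apply N.toFunctor.hom_ext_of_isRightKanExtension β.hom
      ext X
      simp [e, α.unit, β.unit]
    exact NatTrans.congr_app h
  app_μ := by
    set e := N.toFunctor.liftOfIsRightKanExtension β.hom M.toFunctor α.hom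
    have h : M.μ ≫ e = (e ◫ e) ≫ N.μ := by
      apply N.toFunctor.hom_ext_of_isRightKanExtension β.hom
      ext X
      have he : e.app (F.obj X) ≫ β.hom.app X = α.hom.app X := by simp [e]
      calc (M.μ.app (F.obj X) ≫ e.app (F.obj X)) ≫ β.hom.app X
        _ = M.map (α.hom.app X) ≫ α.hom.app X := by rw [Category.assoc, he, α.assoc]
        _ = e.app (M.obj (F.obj X)) ≫ N.map (e.app (F.obj X) ≫ β.hom.app X) ≫ β.hom.app X := by
          rw [he, ← e.naturality_assoc, he]
        _ = ((e ◫ e) ≫ N.μ).app (F.obj X) ≫ β.hom.app X := by simp [β.assoc]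
    intro X
    simpa using NatTrans.congr_app h X

/-- Two monads acting on `F` which are both right Kan extensions of `F` along itself, via their
actions, are isomorphic. -/
noncomputable def isoOfIsRightKanExtension [M.toFunctor.IsRightKanExtension α.hom] : M ≅ N :=
  haveI : IsIso ((monadToFunctor C).map (α.lift β)) :=
    (N.toFunctor.isRightKanExtension_iff_isIso (α.lift β).toNatTrans β.hom α.hom
      (N.toFunctor.liftOfIsRightKanExtension_fac β.hom M.toFunctor α.hom)).1 inferInstance
  haveI : IsIso (α.lift β) := isIso_of_reflects_iso (α.lift β) (monadToFunctor C)
  asIso (α.lift β)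

end MonadAction

/-- The action of the codensity monad of `F` on `F`, given by the counit of the Kan extension. -/
noncomputable def codensityAction (F : A ⥤ C) [F.HasRightKanExtension F] :
    MonadAction (codensityMonad F) F where
  hom := F.rightKanExtensionCounit F
  unit X := by simp [codensityMonad]
  assoc X := by simp [codensityMonad]

instance codensityMonad_isRightKanExtension (F : A ⥤ C) [F.HasRightKanExtension F] :
    (codensityMonad F).toFunctor.IsRightKanExtension (codensityAction F).hom :=
  inferInstanceAs ((F.rightKanExtension F).IsRightKanExtension (F.rightKanExtensionCounit F))

end MonadAction

section JoinPreservingMaps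

/-- The join-preserving map `a ↦ (a ≰ m)` to `2`, whose largest zero is `m`. -/
def notLEHom {L : Type*} [CompleteSemilatticeSup L] (m : L) : sSupHom L Prop where
  toFun a := ¬ a ≤ m
  map_sSup' S := by
    rw [sSup_Prop_eq, Set.exists_mem_image]
    simp only [sSup_le_iff, not_forall, exists_prop]

theorem sSupHom_apply_sSup {L : Type*} [SupSet L] (h : sSupHom L Prop) (S : Set L) :
    h (sSup S) ↔ ∃ a ∈ S, h a := by
  rw [map_sSup, sSup_Prop_eq, Set.exists_mem_image]

theorem sSupHom_apply_mono {L : Type*} [CompleteSemilatticeSup L] (h : sSupHom L Prop) {a b : L}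
    (hab : a ≤ b) (ha : h a) : h b := by
  have h_greatest : IsGreatest {a, b} b := by simpa [IsGreatest, mem_upperBounds] using hab
  rw [← h_greatest.isLUB.sSup_eq, sSupHom_apply_sSup]
  exact ⟨a, Set.mem_insert a {b}, ha⟩

theorem sSupHom_apply_iff_not_le_sSup {L : Type*} [CompleteSemilatticeSup L] (h : sSupHom L Prop)
    (a : L) : h a ↔ ¬ a ≤ sSup {b | ¬ h b} := by
  constructor
  · intro ha hle
    obtain ⟨b, hb, hb'⟩ : ∃ b ∈ {b | ¬ h b}, h b := by
      rw [← sSupHom_apply_sSup]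
      exact sSupHom_apply_mono h hle ha
    exact hb hb'
  · intro hle
    by_contra ha
    exact hle (le_sSup ha)

/-- The self-duality of complete join-semilattices, on underlying sets: every join-preserving map
from `L` to `2` is `a ↦ (a ≰ m)` for a unique `m`. -/
def notLEEquiv (L : Type*) [CompleteSemilatticeSup L] : L ≃ sSupHom L Prop where
  toFun := notLEHom
  invFun h := sSup {b | ¬ h b}
  left_inv m := by
    simp only [notLEHom, sSupHom.coe_mk, not_not]
    exact isLUB_Iic.sSup_eq
  right_inv h := DFunLike.ext _ _ fun a => propext (sSupHom_apply_iff_not_le_sSup h a).symm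

theorem isOpen_setOf_sSupHom_apply {J : Type u} [SupSet J] (j : J) :
    IsOpen {h : sSupHom J Prop | h j} :=
  continuous_Prop.1 ((continuous_apply j).comp continuous_induced_dom)

theorem continuous_sSupHom_of_isOpen_apply {J : Type u} {Z : Type*} [SupSet J] [TopologicalSpace Z]
    {g : Z → sSupHom J Prop} (hg : ∀ j, IsOpen {z | g z j}) : Continuous g :=
  continuous_induced_rng.2 <| continuous_pi fun j => continuous_Prop.2 (hg j)

end JoinPreservingMaps

section LowerVietoris

attribute [local instance] lowerVietorisTopology

theorem not_le_compl_iff_hit {X : Type*} [TopologicalSpace X] (C : Closeds X) (U : Opens X) :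
    ¬ U ≤ C.compl ↔ ((C : Set X) ∩ U).Nonempty := by
  rw [Set.inter_comm, ← Set.not_disjoint_iff_nonempty_inter, ← Set.subset_compl_iff_disjoint_right]
  rfl

/-- The bijection between the closed subsets of `X` and `CJSL(Top(X, 𝕊), 2)`. -/
def closedsEquivSSupHom (X : Type*) [TopologicalSpace X] : Closeds X ≃ sSupHom (Opens X) Prop :=
  (Closeds.complOrderIso X).toEquiv.trans (OrderDual.ofDual.trans (notLEEquiv (Opens X)))

theorem closedsEquivSSupHom_apply {X : Type*} [TopologicalSpace X] (C : Closeds X) (U : Opens X) :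
    closedsEquivSSupHom X C U ↔ ((C : Set X) ∩ U).Nonempty :=
  not_le_compl_iff_hit C U

theorem hit_closedsEquivSSupHom_symm {X : Type*} [TopologicalSpace X] (h : sSupHom (Opens X) Prop)
    (U : Opens X) : (((closedsEquivSSupHom X).symm h : Set X) ∩ U).Nonempty ↔ h U := by
  rw [← closedsEquivSSupHom_apply, Equiv.apply_symm_apply]

/-- The bijection `closedsEquivSSupHom` as a homeomorphism from the lower Vietoris space: the sets
`◇U` correspond to the subbasic open sets of `CJSL(Top(X, 𝕊), 2) ⊆ 𝕊 ^ Top(X, 𝕊)`. -/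
def closedsHomeomorph (X : Type u) [TopologicalSpace X] : Closeds X ≃ₜ sSupHom (Opens X) Prop where
  toEquiv := closedsEquivSSupHom X
  continuous_toFun := continuous_sSupHom_of_isOpen_apply fun U => by
    simpa only [Equiv.toFun_as_coe, closedsEquivSSupHom_apply] using isOpen_hit U.isOpen
  continuous_invFun := continuous_of_hit fun U hU => by
    lift U to Opens X using hU
    simpa only [Equiv.invFun_as_coe, hit_closedsEquivSSupHom_symm] using
      isOpen_setOf_sSupHom_apply U

theorem closedsEquivSSupHom_closure_image {X Y : Type u} [TopologicalSpace X] [TopologicalSpace Y]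
    (f : C(X, Y)) (C : Closeds X) :
    closedsEquivSSupHom Y (Closeds.closure (f '' C)) =
      (closedsEquivSSupHom X C).comp (Opens.comap f : sSupHom (Opens Y) (Opens X)) := by
  ext U
  rw [closedsEquivSSupHom_apply, hit_image f C U.isOpen]
  exact (closedsEquivSSupHom_apply C (Opens.comap f U)).symm

theorem closedsEquivSSupHom_closure_singleton {X : Type u} [TopologicalSpace X] (x : X) :
    closedsEquivSSupHom X (Closeds.closure {x}) = toDualMap (sSupHom.id (Opens X)) x := by
  ext U
  rw [closedsEquivSSupHom_apply, hit_singleton x U.isOpen]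
  rfl

theorem closedsEquivSSupHom_closure_biUnion {X : Type u} [TopologicalSpace X]
    (𝒞 : Closeds (Closeds X)) :
    closedsEquivSSupHom X (Closeds.closure (⋃ C ∈ (𝒞 : Set (Closeds X)), (C : Set X))) =
      (closedsEquivSSupHom (sSupHom (Opens X) Prop)
        (Closeds.closure (closedsHomeomorph X '' (𝒞 : Set (Closeds X))))).comp
          (ofDualMap (ContinuousMap.id (sSupHom (Opens X) Prop))) := by
  ext U
  let evalTrue : Opens (sSupHom (Opens X) Prop) := ⟨{h | h U}, isOpen_setOf_sSupHom_apply U⟩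
  calc closedsEquivSSupHom X (Closeds.closure (⋃ C ∈ (𝒞 : Set (Closeds X)), (C : Set X))) U
    _ ↔ ((𝒞 : Set (Closeds X)) ∩ {C | ((C : Set X) ∩ U).Nonempty}).Nonempty := by
      rw [closedsEquivSSupHom_apply, hit_biUnion _ U.isOpen]
    _ ↔ ((𝒞 : Set (Closeds X)) ∩ closedsHomeomorph X ⁻¹' evalTrue).Nonempty := by
      simp only [← closedsEquivSSupHom_apply]
      rfl
    _ ↔ closedsEquivSSupHom (sSupHom (Opens X) Prop)
          (Closeds.closure (closedsHomeomorph X '' (𝒞 : Set (Closeds X)))) evalTrue := by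
      rw [closedsEquivSSupHom_apply, hit_image _ _ evalTrue.isOpen]

/-- The isomorphism of monads between the lower Vietoris monad and the monad induced by the dual
adjunction `Top(-, 𝕊) ⊣ CJSL(-, 2)`. -/
def lowerVietorisIsoOpensDual : lowerVietorisMonad.{u} ≅ opensDualAdjunction.{u}.toMonad :=
  MonadIso.mk
    (NatIso.ofComponents (F := lowerVietorisMonad.{u}.toFunctor)
      (G := opensDualAdjunction.{u}.toMonad.toFunctor)
      (fun X => TopCat.isoOfHomeo (X := TopCat.of (Closeds X))
        (Y := TopCat.of (sSupHom (Opens X) Prop)) (closedsHomeomorph X))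
      (fun f => TopCat.hom_ext <| ContinuousMap.ext <| closedsEquivSSupHom_closure_image f.hom))
    (fun _ => TopCat.hom_ext <| ContinuousMap.ext closedsEquivSSupHom_closure_singleton)
    (fun _ => TopCat.hom_ext <| ContinuousMap.ext closedsEquivSSupHom_closure_biUnion)

end LowerVietoris

section CodensityOfPowersetKleisli

attribute [local instance] lowerVietorisTopology

/-- The subbasic open subset of `𝕊 ^ A` of the subsets of `A` containing `a`. -/
def powerCoordinate {A : Type*} (a : A) : Opens (A → Prop) :=
  ⟨{S | S a}, continuous_Prop.1 (continuous_apply a)⟩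

/-- The structure map `𝒞 ↦ ⋃ S ∈ 𝒞, S` of `𝕊 ^ A` as an algebra for the lower Vietoris monad. An
element `a` belongs to the union if and only if `𝒞` hits the open set `powerCoordinate a`. -/
def powerUnion (A : Type u) : C(Closeds (A → Prop), A → Prop) where
  toFun 𝒞 a := ((𝒞 : Set (A → Prop)) ∩ powerCoordinate a).Nonempty
  continuous_toFun := continuous_pi fun a =>
    continuous_Prop.2 (isOpen_hit (powerCoordinate a).isOpen)

/-- The action of the lower Vietoris monad on `U_P` by unions. -/
def lowerVietorisAction : MonadAction lowerVietorisMonad.{u} powersetKleisliToTop.{u} where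
  hom :=
    { app A := TopCat.ofHom (powerUnion A.of)
      naturality A B f := TopCat.hom_ext <| ContinuousMap.ext fun (𝒞 : Closeds (A.of → Prop)) =>
        funext fun b => propext <| by
          refine (hit_image _ _ (powerCoordinate b).isOpen).trans ?_
          constructor
          · rintro ⟨S, hS, a, ha, hb⟩
            exact ⟨a, ⟨S, hS, ha⟩, hb⟩
          · rintro ⟨a, ⟨S, hS, ha⟩, hb⟩
            exact ⟨S, hS, a, ha, hb⟩ }
  unit A := TopCat.hom_ext <| ContinuousMap.ext fun (S : A.of → Prop) => funext fun a => propext <|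
    hit_singleton S (powerCoordinate a).isOpen
  assoc A := TopCat.hom_ext <| ContinuousMap.ext fun (_ : Closeds (Closeds (A.of → Prop))) =>
    funext fun a => propext <|
      (hit_biUnion _ (powerCoordinate a).isOpen).trans
        (hit_image (powerUnion A.of) _ (powerCoordinate a).isOpen).symm

variable {X : TopCat.{u}}

/-- The arrow `X ⟶ 𝕊 ^ ι` classifying a family of open subsets of `X`. -/
def opensArrow {ι : Type u} (W : ι → Opens X) : StructuredArrow X powersetKleisliToTop.{u} :=
  StructuredArrow.mk (Y := Kleisli.mk powersetMonad.{u} ι)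
    (TopCat.ofHom (X := X) (Y := ι → Prop)
      ⟨fun x i => x ∈ W i, continuous_pi fun i => continuous_Prop.2 (W i).isOpen⟩)

/-- The arrow `X ⟶ 𝕊` classifying an open subset of `X`, with `𝕊` encoded as the power `𝕊 ^ 1`. -/
abbrev sierpinskiArrow (U : Opens X) : StructuredArrow X powersetKleisliToTop.{u} :=
  opensArrow fun _ : PUnit => U

/-- The family of open subsets of `X` classified by an arrow `f : X ⟶ 𝕊 ^ A`. -/
def arrowOpens (f : StructuredArrow X powersetKleisliToTop.{u}) (a : f.right.of) : Opens X :=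
  (powerCoordinate a).comap (show C(X, f.right.of → Prop) from f.hom.hom)

/-- The morphism from `f : X ⟶ 𝕊 ^ A` to the arrow `X ⟶ 𝕊` classifying the union of the open sets
`arrowOpens f a` for `a ∈ T`. It is the Kleisli morphism `A → P 1` with value `1` exactly on `T`. -/
def arrowUnion (f : StructuredArrow X powersetKleisliToTop.{u}) (T : Set f.right.of) :
    f ⟶ sierpinskiArrow (⨆ a ∈ T, arrowOpens f a) :=
  StructuredArrow.homMk
    (Kleisli.Hom.mk (↾(fun a : f.right.of => ({_u | a ∈ T} : Set PUnit))))
    (TopCat.hom_ext <| ContinuousMap.ext fun x => funext fun _ => propext <| by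
      change (∃ a, x ∈ arrowOpens f a ∧ a ∈ T) ↔ x ∈ ⨆ a ∈ T, arrowOpens f a
      simp only [Opens.mem_iSup, exists_prop, and_comm])

variable (s : Limits.Cone (StructuredArrow.proj X powersetKleisliToTop.{u} ⋙
  powersetKleisliToTop.{u}))

/-- The leg of a cone at `f : X ⟶ 𝕊 ^ A`, as a continuous map to `𝕊 ^ A`. -/
def coneLeg (f : StructuredArrow X powersetKleisliToTop.{u}) : C(s.pt, f.right.of → Prop) :=
  (s.π.app f).hom

/-- The truth value which a point of a cone assigns to `U`, through the leg at the arrow `X ⟶ 𝕊`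
classifying `U`. -/
def coneTruth (z : s.pt) (U : Opens X) : Prop :=
  coneLeg s (sierpinskiArrow U) z PUnit.unit

theorem coneTruth_biSup_arrowOpens (z : s.pt) (f : StructuredArrow X powersetKleisliToTop.{u})
    (T : Set f.right.of) :
    coneTruth s z (⨆ a ∈ T, arrowOpens f a) ↔ ∃ a ∈ T, coneLeg s f z a := by
  have h_leg : (powersetKleisliToTop.map (arrowUnion f T).right).hom (coneLeg s f z) =
      coneLeg s (sierpinskiArrow (⨆ a ∈ T, arrowOpens f a)) z :=
    ConcreteCategory.congr_hom (s.w (arrowUnion f T)) z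
  rw [coneTruth, ← h_leg]
  exact exists_congr fun _ => and_comm

theorem coneTruth_arrowOpens (z : s.pt) (f : StructuredArrow X powersetKleisliToTop.{u})
    (a : f.right.of) : coneTruth s z (arrowOpens f a) ↔ coneLeg s f z a := by
  simpa only [Set.mem_singleton_iff, iSup_iSup_eq_left, exists_eq_left] using
    coneTruth_biSup_arrowOpens s z f {a}

theorem coneTruth_sSup (z : s.pt) (S : Set (Opens X)) :
    coneTruth s z (sSup S) ↔ ∃ U ∈ S, coneTruth s z U := by
  let f := opensArrow fun U : S => (U : Opens X)
  have h_sSup : sSup S = ⨆ a ∈ Set.univ, arrowOpens f a := by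
    simp only [iSup_univ, sSup_eq_iSup']
    rfl
  rw [h_sSup, coneTruth_biSup_arrowOpens]
  simp only [Set.mem_univ, true_and, ← coneTruth_arrowOpens]
  change (∃ U : S, coneTruth s z U) ↔ _
  simp only [Subtype.exists, exists_prop]

/-- The truth values assigned by the points of a cone, as a map to `CJSL(Top(X, 𝕊), 2)`. -/
def coneTruthHom : C(s.pt, sSupHom (Opens X) Prop) where
  toFun z :=
    { toFun := coneTruth s z
      map_sSup' S := by
        rw [sSup_Prop_eq, Set.exists_mem_image]
        exact propext (coneTruth_sSup s z S) }
  continuous_toFun := continuous_sSupHom_of_isOpen_apply fun _ =>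
    continuous_Prop.1 ((continuous_apply PUnit.unit).comp (coneLeg s _).continuous)

/-- The map from the apex of a cone to the lower Vietoris space of `X`, sending a point to the
closed set hitting exactly the open sets to which the point assigns truth. -/
def coneLift : C(s.pt, Closeds X) :=
  ((closedsHomeomorph X).symm : C(sSupHom (Opens X) Prop, Closeds X)).comp (coneTruthHom s)

theorem hit_coneLift (z : s.pt) (U : Opens X) :
    ((coneLift s z : Set X) ∩ U).Nonempty ↔ coneTruth s z U :=
  hit_closedsEquivSSupHom_symm (coneTruthHom s z) U

theorem powerUnion_map_apply_iff_hit (f : StructuredArrow X powersetKleisliToTop.{u})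
    (C : Closeds X) (a : f.right.of) :
    powerUnion f.right.of (lowerVietorisMonad.map f.hom C) a ↔
      ((C : Set X) ∩ arrowOpens f a).Nonempty :=
  hit_image f.hom _ (powerCoordinate a).isOpen

/-- The lower Vietoris functor is a pointwise right Kan extension of `U_P` along itself. -/
def lowerVietorisIsPointwiseRightKanExtension :
    (Functor.RightExtension.mk lowerVietorisMonad.{u}.toFunctor
      lowerVietorisAction.{u}.hom).IsPointwiseRightKanExtension := fun X =>
  { lift := fun s => TopCat.ofHom (coneLift s)
    fac := fun s f => TopCat.hom_ext <| ContinuousMap.ext fun z => funext fun a => propext <|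
      calc powerUnion f.right.of (lowerVietorisMonad.map f.hom (coneLift s z)) a
        _ ↔ ((coneLift s z : Set X) ∩ arrowOpens f a).Nonempty :=
          powerUnion_map_apply_iff_hit f (coneLift s z) a
        _ ↔ coneTruth s z (arrowOpens f a) := hit_coneLift s z (arrowOpens f a)
        _ ↔ coneLeg s f z a := coneTruth_arrowOpens s z f a
    uniq := fun s m hm => TopCat.hom_ext <| ContinuousMap.ext fun z =>
      closeds_ext_of_hit fun U hU => by
        let f := sierpinskiArrow (⟨U, hU⟩ : Opens X)
        have h_leg : powerUnion PUnit (lowerVietorisMonad.map f.hom (m z)) = coneLeg s f z :=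
          ConcreteCategory.congr_hom (hm f) z
        refine Iff.trans ?_ (hit_coneLift s z ⟨U, hU⟩).symm
        rw [coneTruth, ← h_leg]
        exact (powerUnion_map_apply_iff_hit f (m z) PUnit.unit).symm }

end CodensityOfPowersetKleisli

theorem mainTheorem5 :
    (∃ _ : powersetKleisliToTop.{u}.HasPointwiseRightKanExtension powersetKleisliToTop.{u},
      Nonempty (lowerVietorisMonad.{u} ≅ codensityMonad powersetKleisliToTop.{u})) ∧
    (∃ e : lowerVietorisMonad.{u} ≅ opensDualAdjunction.{u}.toMonad,
      ∀ (X : TopCat.{u}) (C : Closeds X) (U : Opens X),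
        DFunLike.coe (F := sSupHom (Opens X) Prop) (e.hom.app X C) U ↔
          ((C : Set X) ∩ U).Nonempty) := by
  have h_kan := lowerVietorisIsPointwiseRightKanExtension.{u}
  have h_pointwise := h_kan.hasPointwiseRightKanExtension
  have : lowerVietorisMonad.{u}.toFunctor.IsRightKanExtension lowerVietorisAction.{u}.hom :=
    h_kan.isRightKanExtension
  refine ⟨⟨h_pointwise, ⟨?_⟩⟩, lowerVietorisIsoOpensDual, fun _ C U => ?_⟩
  · exact lowerVietorisAction.isoOfIsRightKanExtension (codensityAction powersetKleisliToTop)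
  · exact closedsEquivSSupHom_apply C U
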